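/- There is an absolute constant $C>0$ such that the following holds. Let $G=(V,E)$ be a finite simple graph with $n$ vertices, maximum degree $\Delta\ge 3$ and treewidth $t\ge 1$. Suppose that each vertex $v\in V$ is associated with a finite color list $L_v$ such that $\deg_G(v)+2\le |L_v|\le q$, where $q$ is a positive integer. A list coloring of $G$ assigns to each vertex $v$ a color from $L_v$ such that adjacent vertices receive distinct colors. The Glauber dynamics is the Markov chain on the set of all list colorings which in each step chooses a vertex $v\in V$ uniformly at random and resamples the color of $v$ from the uniform distribution over list colorings conditioned on the current colors of all other vertices. Its mixing time is the smallest $T$ such that, from every initial list coloring, the distribution of the chain after $T$ steps is within total variation distance $1/4$ of the uniform distribution over list colorings. Then this mixing time is finite and at most $n^{C\,t\,(\Delta+\log q)}$. -/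

import Mathlib

/-- A tree decomposition of the graph `G`: a (finite, nonempty) tree whose nodes carry sets of
vertices of `G` (bags), such that the endpoints of every edge lie together in some bag and, for
every vertex `v`, the nodes whose bags contain `v` form a (nonempty) connected subtree. -/
structure TreeDecomposition {V : Type*} (G : SimpleGraph V) where
  size : ℕ
  tree : SimpleGraph (Fin size)
  isTree : tree.IsTree
  bag : Fin size → Finset V
  edge_mem : ∀ u v : V, G.Adj u v → ∃ i, u ∈ bag i ∧ v ∈ bag i
  connected : ∀ v : V, (tree.induce {i | v ∈ bag i}).Connected

/-- The width of a tree decomposition: the largest bag size minus one. -/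
def TreeDecomposition.width {V : Type*} {G : SimpleGraph V} (D : TreeDecomposition G) : ℕ :=
  (Finset.univ.sup fun i => (D.bag i).card) - 1

/-- The treewidth: the minimum width of a tree decomposition (the minimum is over a nonempty set
when `V` is finite, see `exists_width_eq_treewidth`). -/
noncomputable def treewidth {V : Type*} (G : SimpleGraph V) : ℕ :=
  sInf (Set.range fun D : TreeDecomposition G => D.width)

/-- The decomposition with one bag that contains all vertices. -/
def TreeDecomposition.trivial {V : Type*} [Fintype V] (G : SimpleGraph V) :
    TreeDecomposition G where
  size := 1
  tree := ⊥
  isTree := .of_subsingleton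
  bag := fun _ => Finset.univ
  edge_mem := fun _ _ _ => ⟨0, Finset.mem_univ _, Finset.mem_univ _⟩
  connected := fun v =>
    haveI : Nonempty {_i : Fin 1 | v ∈ (Finset.univ : Finset V)} := ⟨⟨0, Finset.mem_univ v⟩⟩
    (SimpleGraph.IsTree.of_subsingleton).connected

theorem exists_width_eq_treewidth {V : Type*} [Fintype V] (G : SimpleGraph V) :
    ∃ D : TreeDecomposition G, D.width = treewidth G :=
  Nat.sInf_mem (s := Set.range fun D : TreeDecomposition G => D.width)
    ⟨_, TreeDecomposition.trivial G, rfl⟩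

/-- The list colorings of `G` with color lists `L`: every vertex gets a color from its list, and
adjacent vertices get distinct colors. -/
abbrev ListColoring {V α : Type*} (G : SimpleGraph V) (L : V → Finset α) : Type _ :=
  {σ : (v : V) → L v // ∀ u v : V, G.Adj u v → (σ u : α) ≠ (σ v : α)}

section Glauber

variable {V α : Type*} [Fintype V] (G : SimpleGraph V) (L : V → Finset α)

noncomputable instance ListColoring.instFintype : Fintype (ListColoring G L) := by
  classical exact inferInstance

noncomputable instance ListColoring.instDecidableEq : DecidableEq (ListColoring G L) :=
  Classical.decEq _

/-- The uniform distribution over list colorings. -/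
noncomputable def uniformColoring (_ : ListColoring G L) : ℝ :=
  1 / Fintype.card (ListColoring G L)

/-- The list colorings that agree with `σ` on all vertices other than `v`. -/
noncomputable def agreeOff (v : V) (σ : ListColoring G L) : Finset (ListColoring G L) :=
  {τ : ListColoring G L | ∀ u, u ≠ v → τ.1 u = σ.1 u}.toFinite.toFinset

open Classical in
/-- Resampling the color of `v` conditionally on the colors of all other vertices in `σ`: the
uniform distribution over list colorings, conditioned on agreeing with `σ` outside `v`. -/
noncomputable def siteUpdate (v : V) (σ τ : ListColoring G L) : ℝ :=
  if τ ∈ agreeOff G L v σ then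
    uniformColoring G L τ / ∑ ρ ∈ agreeOff G L v σ, uniformColoring G L ρ
  else 0

/-- The transition matrix of the Glauber dynamics: choose a vertex uniformly at random and
resample its color conditionally on the colors of all other vertices. -/
noncomputable def glauber : Matrix (ListColoring G L) (ListColoring G L) ℝ :=
  fun σ τ => (1 / (Fintype.card V : ℝ)) * ∑ v : V, siteUpdate G L v σ τ

/-- The total variation distance of two distributions on a finite set. -/
noncomputable def tvDist {Ω : Type*} [Fintype Ω] (p q : Ω → ℝ) : ℝ :=
  (1 / 2) * ∑ x, |p x - q x|

/-- `T` is the mixing time of the Glauber dynamics for uniformly random list colorings: the least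
number of steps after which, from every initial list coloring, the distribution of the chain is
within total variation distance `1/4` of the uniform distribution. -/
def IsMixingTime (T : ℕ) : Prop :=
  IsLeast {k : ℕ | ∀ σ : ListColoring G L,
    tvDist ((glauber G L ^ k) σ) (uniformColoring G L) ≤ 1 / 4} T

end Glauber

/-! The proof is a canonical-path bound on the spectral gap, run along a linear layout of the graph.
In every tree decomposition some bag is a balanced separator of any given vertex set. Recursive
separation therefore orders the vertices so that every prefix has at most `w = (t + 1) * (log₂ n +
1)` vertices with a neighbour still to come (`TreeDecomposition.hasLayout`).

To move from `σ` to `τ`, scan the layout. The stage-`i` hybrid has the colors of `τ` on processed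
vertices without later neighbours and those of `σ` on unprocessed ones; the boundary is filled
greedily (`exists_hybrid`). Consecutive hybrids differ on a set `W` of at most `w + 1` vertices.
Since each list has two colors more than the degree, they are joined by single-site moves inside `W`
(`IsProperOn.reflTransGen_recolorStep`). A coloring met at stage `i`, the hybrid with `σ` and `τ`
exchanged, and the colors on `W` determine the pair (`card_pairs_le`), so congestion is at most `N *
q ^ (2 * (w + 1))`, where `N` counts the colorings.

The resulting Poincaré inequality gives a gap of at least `1 / A` with `A = n ^ 3 * q ^ (3 * (w + 1)
+ 1)`. The chain is an average of orthogonal projections, so negative eigenvalues do not occur and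
the gap alone controls `L²` decay. As `N ≤ q ^ n`, the time `2 * A * n * q` suffices, and its
logarithm is `O(t * log n * (Δ + log q))`. -/

/-! ### Balanced separators from tree decompositions -/

namespace TreeDecomposition

variable {V : Type*} {G : SimpleGraph V} (D : TreeDecomposition G)

theorem card_bag_le (i : Fin D.size) : (D.bag i).card ≤ D.width + 1 := by
  have h := Finset.le_sup (f := fun i => (D.bag i).card) (Finset.mem_univ i)
  unfold width
  omega

theorem exists_mem_bag (v : V) : ∃ i, v ∈ D.bag i := by
  obtain ⟨⟨i, hi⟩⟩ := (D.connected v).nonempty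
  exact ⟨i, hi⟩

/-- The nodes whose bags contain `u` stay connected after isolating a node whose bag omits `u`. -/
theorem reachable_deleteIncidenceSet {x i j : Fin D.size} {u : V} (hx : u ∉ D.bag x)
    (hi : u ∈ D.bag i) (hj : u ∈ D.bag j) :
    (D.tree.deleteIncidenceSet x).Reachable i j := by
  have h := (D.connected u).preconnected ⟨i, hi⟩ ⟨j, hj⟩
  let φ : D.tree.induce {i | u ∈ D.bag i} →g D.tree.deleteIncidenceSet x :=
    { toFun := fun z => z.1
      map_rel' := by
        rintro ⟨a, ha⟩ ⟨b, hb⟩ hab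
        rw [SimpleGraph.deleteIncidenceSet_adj]
        refine ⟨hab, ?_, ?_⟩
        · rintro rfl; exact hx ha
        · rintro rfl; exact hx hb }
  exact h.map φ

end TreeDecomposition

/-- Take for `y` the node just before the first visit to `x`; the walk up to there avoids `x`. -/
theorem SimpleGraph.Walk.exists_adj_reachable_deleteIncidenceSet {ι : Type*} {T : SimpleGraph ι}
    {z x : ι} (p : T.Walk z x) (hz : z ≠ x) :
    ∃ y, T.Adj x y ∧ (T.deleteIncidenceSet x).Reachable y z := by
  induction p with
  | nil => exact absurd rfl hz
  | @cons a b c h p ih =>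
    by_cases hb : b = c
    · subst hb
      exact ⟨a, h.symm, .refl _⟩
    · obtain ⟨y, hy, hr⟩ := ih hb
      refine ⟨y, hy, hr.trans (SimpleGraph.Adj.reachable ?_)⟩
      rw [SimpleGraph.deleteIncidenceSet_adj]
      exact ⟨h.symm, hb, hz⟩

/-- A map that sends every node of a finite tree to a neighbour swaps two nodes. -/
theorem SimpleGraph.IsTree.exists_swap {ι : Type*} [Finite ι] {T : SimpleGraph ι} (hT : T.IsTree)
    (h : ι → ι) (hh : ∀ x, T.Adj x (h x)) : ∃ x, h (h x) = x := by
  classical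
  cases nonempty_fintype ι
  -- A tree has fewer edges than nodes, so two nodes `x ≠ y` choose the same edge.
  have hlt : T.edgeFinset.card < (Finset.univ : Finset ι).card := by
    rw [Finset.card_univ, ← hT.card_edgeFinset]
    exact Nat.lt_succ_self _
  obtain ⟨x, -, y, -, hxy, he⟩ := Finset.exists_ne_map_eq_of_card_lt_of_maps_to hlt
    (f := fun x => s(x, h x)) (fun x _ => by simpa using hh x)
  rcases Sym2.eq_iff.1 he with ⟨h1, -⟩ | ⟨h1, h2⟩
  · exact absurd h1 hxy
  · exact ⟨x, by rw [h2, ← h1]⟩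

open scoped Classical in
/-- Some bag of a tree decomposition is a balanced separator of a given vertex set `U`. -/
theorem TreeDecomposition.exists_balanced_bag {V : Type*} {G : SimpleGraph V}
    (D : TreeDecomposition G) (U : Finset V) :
    ∃ (x : Fin D.size) (c : V → (D.tree.deleteIncidenceSet x).ConnectedComponent),
      (∀ u v, G.Adj u v → u ∉ D.bag x → v ∉ D.bag x → c u = c v) ∧
      ∀ k, 2 * ((U \ D.bag x).filter fun u => c u = k).card ≤ U.card := by
  choose node hnode using D.exists_mem_bag
  let c (x : Fin D.size) (u : V) := (D.tree.deleteIncidenceSet x).connectedComponentMk (node u)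
  -- If no bag works, each node `x` has a heavy component beside it; point `x` to its neighbour
  -- there. Two nodes then point at each other, and the two sides of that edge are disjoint and each
  -- hold more than half of `U`.
  by_contra! hcon
  have key : ∀ x, ∃ y, D.tree.Adj x y ∧
      U.card < 2 * (U.filter fun u => (D.tree.deleteEdges {s(x, y)}).Reachable y (node u)).card := by
    intro x
    obtain ⟨k, hk⟩ := hcon x (c x) (by
      intro u v huv hu hv
      obtain ⟨i, hiu, hiv⟩ := D.edge_mem u v huv
      rw [SimpleGraph.ConnectedComponent.eq]
      exact (D.reachable_deleteIncidenceSet hu (hnode u) hiu).trans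
        (D.reachable_deleteIncidenceSet hv hiv (hnode v)))
    have hne : ((U \ D.bag x).filter fun u => c x u = k).Nonempty := by
      rw [← Finset.card_pos]; omega
    obtain ⟨u, hu⟩ := hne
    rw [Finset.mem_filter, Finset.mem_sdiff] at hu
    obtain ⟨⟨-, hux⟩, huk⟩ := hu
    have hnx : node u ≠ x := fun h => hux (h ▸ hnode u)
    obtain ⟨p⟩ := D.isTree.connected.preconnected (node u) x
    obtain ⟨y, hy, hr⟩ := p.exists_adj_reachable_deleteIncidenceSet hnx
    refine ⟨y, hy, hk.trans_le ?_⟩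
    refine Nat.mul_le_mul_left _ (Finset.card_le_card fun v hv => ?_)
    rw [Finset.mem_filter, Finset.mem_sdiff] at hv
    rw [Finset.mem_filter]
    refine ⟨hv.1.1, ?_⟩
    have huv : (D.tree.deleteIncidenceSet x).Reachable (node u) (node v) :=
      SimpleGraph.ConnectedComponent.eq.1 (huk.trans hv.2.symm)
    -- Isolating `x` removes every edge at `x`, so removing only `s(x, y)` keeps all these
    -- connections.
    refine (hr.trans huv).mono fun a b hab => ?_
    rw [SimpleGraph.deleteIncidenceSet_adj] at hab
    rw [SimpleGraph.deleteEdges_adj]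
    refine ⟨hab.1, fun h => ?_⟩
    rcases Sym2.eq_iff.1 (Set.mem_singleton_iff.1 h) with ⟨h1, -⟩ | ⟨-, h2⟩
    · exact hab.2.1 h1
    · exact hab.2.2 h2
  choose h hadj hheavy using key
  obtain ⟨x, hx⟩ := D.isTree.exists_swap h hadj
  have h1 := hheavy x
  have h2 := hheavy (h x)
  rw [hx, Sym2.eq_swap] at h2
  have hdisj : Disjoint
      (U.filter fun u => (D.tree.deleteEdges {s(x, h x)}).Reachable (h x) (node u))
      (U.filter fun u => (D.tree.deleteEdges {s(x, h x)}).Reachable x (node u)) := by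
    rw [Finset.disjoint_left]
    intro u hu hu'
    rw [Finset.mem_filter] at hu hu'
    have hb := SimpleGraph.isAcyclic_iff_forall_adj_isBridge.1 D.isTree.isAcyclic (hadj x)
    rw [SimpleGraph.isBridge_iff] at hb
    first
      | exact hb.2 (hu'.2.trans hu.2.symm)
      | exact hb (hu'.2.trans hu.2.symm)
  have h3 := Finset.card_le_card (Finset.union_subset
    (Finset.filter_subset (fun u => (D.tree.deleteEdges {s(x, h x)}).Reachable (h x) (node u)) U)
    (Finset.filter_subset (fun u => (D.tree.deleteEdges {s(x, h x)}).Reachable x (node u)) U))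
  rw [Finset.card_union_of_disjoint hdisj] at h3
  omega

/-! ### Linear layouts of small vertex separation -/

section Layout

open scoped Classical

variable {V : Type*} (G : SimpleGraph V)

/-- The vertices of the list `l₁` that have a neighbour in `l₂`. -/
noncomputable def listBoundary (l₁ l₂ : List V) : Finset V :=
  l₁.toFinset.filter fun x => ∃ y ∈ l₂, G.Adj x y

theorem mem_listBoundary {l₁ l₂ : List V} {x : V} :
    x ∈ listBoundary G l₁ l₂ ↔ x ∈ l₁ ∧ ∃ y ∈ l₂, G.Adj x y := by
  simp [listBoundary]

/-- The vertex set `U` has a linear layout of vertex separation number at most `w`. -/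
def HasLayout (U : Finset V) (w : ℕ) : Prop :=
  ∃ l : List V, l.Nodup ∧ (∀ v, v ∈ l ↔ v ∈ U) ∧
    ∀ l₁ l₂, l = l₁ ++ l₂ → (listBoundary G l₁ l₂).card ≤ w

variable {G}

theorem HasLayout.empty (w : ℕ) : HasLayout G ∅ w := by
  refine ⟨[], List.nodup_nil, by simp, fun l₁ l₂ h => ?_⟩
  obtain ⟨rfl, rfl⟩ := List.append_eq_nil_iff.1 h.symm
  simp [listBoundary]

/-- Concatenate the layouts. With no edges across, a cut has boundary only in the piece it splits,
so the widths do not add. -/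
theorem HasLayout.union {A B : Finset V} {w : ℕ} (hA : HasLayout G A w) (hB : HasLayout G B w)
    (hd : Disjoint A B) (hAB : ∀ a ∈ A, ∀ b ∈ B, ¬ G.Adj a b) : HasLayout G (A ∪ B) w := by
  obtain ⟨a, ha, hamem, haw⟩ := hA
  obtain ⟨b, hb, hbmem, hbw⟩ := hB
  refine ⟨a ++ b, ha.append hb ?_, fun v => by simp [hamem, hbmem], fun l₁ l₂ h => ?_⟩
  · intro x hx hx'
    exact Finset.disjoint_left.1 hd ((hamem x).1 hx) ((hbmem x).1 hx')
  rcases List.append_eq_append_iff.1 h with ⟨m, rfl, hm⟩ | ⟨m, hm, rfl⟩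
  · refine (Finset.card_le_card fun x hx => ?_).trans (hbw m l₂ hm)
    rw [mem_listBoundary] at hx ⊢
    obtain ⟨hx, y, hy, hxy⟩ := hx
    refine ⟨(List.mem_append.1 hx).resolve_left fun hxa => ?_, y, hy, hxy⟩
    exact hAB x ((hamem x).1 hxa) y ((hbmem y).1 (by simp [hm, hy])) hxy
  · refine (Finset.card_le_card fun x hx => ?_).trans (haw l₁ m hm)
    rw [mem_listBoundary] at hx ⊢
    obtain ⟨hx, y, hy, hxy⟩ := hx
    refine ⟨hx, y, (List.mem_append.1 hy).resolve_right fun hyb => ?_, hxy⟩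
    exact hAB x ((hamem x).1 (by simp [hm, hx])) y ((hbmem y).1 hyb) hxy

/-- Putting `U ∩ X` first adds at most `X.card` vertices to any boundary. -/
theorem HasLayout.of_sdiff {U X : Finset V} {w : ℕ} (h : HasLayout G (U \ X) w) :
    HasLayout G U (w + X.card) := by
  obtain ⟨l, hl, hmem, hw⟩ := h
  refine ⟨(U ∩ X).toList ++ l, (Finset.nodup_toList _).append hl ?_, ?_, fun l₁ l₂ h => ?_⟩
  · intro x hx hx'
    rw [hmem, Finset.mem_sdiff] at hx'
    rw [Finset.mem_toList, Finset.mem_inter] at hx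
    exact hx'.2 hx.2
  · intro v
    rw [List.mem_append, hmem, Finset.mem_toList, Finset.mem_inter, Finset.mem_sdiff]
    tauto
  rcases List.append_eq_append_iff.1 h with ⟨m, rfl, hm⟩ | ⟨m, hm, rfl⟩
  · refine (Finset.card_le_card (t := listBoundary G m l₂ ∪ X) fun x hx => ?_).trans
      ((Finset.card_union_le _ _).trans (Nat.add_le_add_right (hw m l₂ hm) _))
    rw [mem_listBoundary] at hx
    rw [Finset.mem_union, mem_listBoundary]
    rcases List.mem_append.1 hx.1 with h1 | h1
    · exact Or.inr (Finset.mem_inter.1 (Finset.mem_toList.1 h1)).2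
    · exact Or.inl ⟨h1, hx.2⟩
  · refine (Finset.card_le_card (t := X) fun x hx => ?_).trans (Nat.le_add_left _ _)
    rw [mem_listBoundary] at hx
    have : x ∈ (U ∩ X).toList := by rw [hm]; exact List.mem_append_left _ hx.1
    exact (Finset.mem_inter.1 (Finset.mem_toList.1 this)).2

theorem HasLayout.of_fibers {κ : Type*} {U : Finset V} {w : ℕ} (c : V → κ)
    (hc : ∀ u ∈ U, ∀ v ∈ U, G.Adj u v → c u = c v)
    (h : ∀ k, HasLayout G (U.filter fun u => c u = k) w) : HasLayout G U w := by
  have key : ∀ s : Finset κ, HasLayout G (U.filter fun u => c u ∈ s) w := by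
    intro s
    induction s using Finset.induction_on with
    | empty => simpa using HasLayout.empty w
    | insert k s hk ih =>
      have he : (U.filter fun u => c u ∈ insert k s) =
          (U.filter fun u => c u = k) ∪ U.filter fun u => c u ∈ s := by
        ext v
        simp only [Finset.mem_filter, Finset.mem_insert, Finset.mem_union]
        tauto
      rw [he]
      refine (h k).union ih ?_ ?_
      · rw [Finset.disjoint_left]
        intro v hv hv'
        rw [Finset.mem_filter] at hv hv'
        exact hk (hv.2 ▸ hv'.2)
      · intro a ha b hb hab
        rw [Finset.mem_filter] at ha hb
        exact hk (ha.2 ▸ hc a ha.1 b hb.1 hab ▸ hb.2)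
  have := key (U.image c)
  rwa [Finset.filter_true_of_mem fun u hu => Finset.mem_image_of_mem c hu] at this

/-- Recursive balanced separation bounds the vertex separation number. -/
theorem TreeDecomposition.hasLayout (D : TreeDecomposition G) (k : ℕ) :
    ∀ U : Finset V, U.card < 2 ^ k → HasLayout G U ((D.width + 1) * k) := by
  induction k with
  | zero =>
    intro U hU
    have hU' : U = ∅ := by simpa using hU
    exact hU' ▸ HasLayout.empty _
  | succ k ih =>
    intro U hU
    obtain ⟨x, c, hc, hbal⟩ := D.exists_balanced_bag U
    -- Each piece has fewer than `2 ^ k` vertices, and all pieces share one budget; the bag pays for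
    -- one more level.
    have h1 : HasLayout G (U \ D.bag x) ((D.width + 1) * k) := by
      refine HasLayout.of_fibers c (fun u hu v hv huv => hc u v huv ?_ ?_) fun j => ih _ ?_
      · exact (Finset.mem_sdiff.1 hu).2
      · exact (Finset.mem_sdiff.1 hv).2
      · have := hbal j
        rw [pow_succ] at hU
        omega
    obtain ⟨l, hl, hmem, hw⟩ := h1.of_sdiff
    refine ⟨l, hl, hmem, fun l₁ l₂ h => (hw l₁ l₂ h).trans ?_⟩
    rw [Nat.mul_succ]
    exact Nat.add_le_add_left (D.card_bag_le x) _

end Layout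

/-! ### Greedy extension and single-vertex recoloring -/

section Recoloring

open scoped Classical

variable {V α : Type*} (G : SimpleGraph V) (L : V → Finset α)

/-- A choice of colors from the lists in which no edge inside `Z` is monochromatic. -/
def IsProperOn (Z : Set V) (c : V → α) : Prop :=
  (∀ v, c v ∈ L v) ∧ ∀ u ∈ Z, ∀ v ∈ Z, G.Adj u v → c u ≠ c v

/-- Recoloring a single vertex of `W`, with a result that is proper on `Z`. -/
def RecolorStep (Z : Set V) (W : Finset V) (c d : V → α) : Prop :=
  IsProperOn G L Z d ∧ ∃ v ∈ W, ∃ a, d = Function.update c v a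

variable {G L}

theorem IsProperOn.mono {Z Y : Set V} {c : V → α} (h : IsProperOn G L Z c) (hYZ : Y ⊆ Z) :
    IsProperOn G L Y c :=
  ⟨h.1, fun u hu v hv => h.2 u (hYZ hu) v (hYZ hv)⟩

theorem IsProperOn.update {Z : Set V} {c : V → α} (h : IsProperOn G L Z c) {v : V} {b : α}
    (hb : b ∈ L v) (hv : ∀ u, G.Adj v u → c u ≠ b) :
    IsProperOn G L (insert v Z) (Function.update c v b) := by
  refine ⟨fun u => ?_, fun x hx y hy hxy => ?_⟩
  · by_cases hu : u = v
    · subst hu; simpa using hb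
    · simpa [hu] using h.1 u
  · by_cases hxv : x = v
    · subst hxv
      have hyx : y ≠ x := hxy.ne'
      simpa [hyx] using (hv y hxy).symm
    · by_cases hyv : y = v
      · subst hyv
        simpa [hxv] using hv x hxy.symm
      · simpa [hxv, hyv] using h.2 x (hx.resolve_left hxv) y (hy.resolve_left hyv) hxy

variable [Fintype V] [DecidableRel G.Adj]

/-- The neighbours block at most `G.degree v` colors and `a` one more. The extra `a` is a color that
a neighbour is about to take. -/
theorem exists_color_avoiding {v : V} (hL : G.degree v + 2 ≤ (L v).card) (c : V → α) (a : α) :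
    ∃ b ∈ L v, b ≠ a ∧ ∀ u, G.Adj v u → c u ≠ b := by
  have hcard : (insert a ((G.neighborFinset v).image c)).card < (L v).card := by
    have h1 := Finset.card_insert_le a ((G.neighborFinset v).image c)
    have h2 := Finset.card_image_le (s := G.neighborFinset v) (f := c)
    rw [G.card_neighborFinset_eq_degree] at h2
    omega
  obtain ⟨b, hb, hbn⟩ := Finset.exists_mem_notMem_of_card_lt_card hcard
  rw [Finset.mem_insert, not_or] at hbn
  refine ⟨b, hb, hbn.1, fun u hu hub => hbn.2 ?_⟩
  exact Finset.mem_image.2 ⟨u, by simpa using hu, hub⟩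

/-- Greedy coloring: the values of `c` on `W` are placeholders, replaced one vertex at a time. -/
theorem IsProperOn.exists_extension (hL : ∀ v, G.degree v + 2 ≤ (L v).card) (W : Finset V) :
    ∀ c : V → α, IsProperOn G L {v | v ∉ W} c →
      ∃ d, IsProperOn G L Set.univ d ∧ ∀ v ∉ W, d v = c v := by
  induction W using Finset.induction_on with
  | empty => exact fun c hc => ⟨c, hc.mono (by simp), fun _ _ => rfl⟩
  | insert u W hu ih =>
    intro c hc
    obtain ⟨b, hb, -, hbn⟩ := exists_color_avoiding (hL u) c (c u)
    obtain ⟨d, hd, hdc⟩ := ih (Function.update c u b) ((hc.update hb hbn).mono fun v hv => by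
      by_cases hvu : v = u
      · exact Or.inl hvu
      · refine Or.inr fun h => ?_
        exact (Finset.mem_insert.1 h).elim hvu hv)
    refine ⟨d, hd, fun v hv => ?_⟩
    rw [Finset.mem_insert, not_or] at hv
    rw [hdc v hv.2, Function.update_of_ne hv.1]

/-- Two colorings that agree outside `W` are connected by recoloring vertices of `W`. -/
theorem IsProperOn.reflTransGen_recolorStep (hL : ∀ v, G.degree v + 2 ≤ (L v).card)
    (W : Finset V) : ∀ (Z : Set V) (c d : V → α), IsProperOn G L Z c → IsProperOn G L Z d →
      (∀ v ∉ W, c v = d v) → Relation.ReflTransGen (RecolorStep G L Z W) c d := by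
  induction W using Finset.induction_on with
  | empty =>
    intro Z c d _ _ h
    rw [funext fun v => h v (Finset.notMem_empty v)]
  | insert u W hu ih =>
    intro Z c d hc hd hcd
    -- A recoloring that ignores conflicts at `u` can be made proper: before each move of some `v`
    -- to `a`, move `u` to a color different from `a` and from its neighbours' colors.
    have hlift : ∀ e, Relation.ReflTransGen (RecolorStep G L (Z \ {u}) W) c e →
        ∃ e', Relation.ReflTransGen (RecolorStep G L Z (insert u W)) c e' ∧
          IsProperOn G L Z e' ∧ ∀ v, v ≠ u → e' v = e v := by
      intro e he
      induction he with
      | refl => exact ⟨c, .refl, hc, fun _ _ => rfl⟩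
      | @tail e e₁ _ hstep ihe =>
        obtain ⟨e', hr, hp, heq⟩ := ihe
        obtain ⟨hp₁, v, hv, a, rfl⟩ := hstep
        have hvu : v ≠ u := fun h => hu (h ▸ hv)
        obtain ⟨b, hb, hba, hbn⟩ := exists_color_avoiding (hL u) e' a
        have hp₂ : IsProperOn G L Z (Function.update e' u b) :=
          (hp.update hb hbn).mono (Set.subset_insert _ _)
        have heq₃ : ∀ x, x ≠ u →
            Function.update (Function.update e' u b) v a x = Function.update e v a x := by
          intro x hx
          by_cases hxv : x = v
          · subst hxv; simp
          · simp [hxv, hx, heq x hx]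
        have hu₃ : Function.update (Function.update e' u b) v a u = b := by
          simp [hvu.symm]
        have hbn₃ : ∀ x, G.Adj u x → Function.update (Function.update e' u b) v a x ≠ b := by
          intro x hx
          by_cases hxv : x = v
          · subst hxv; simpa using hba.symm
          · simpa [hxv, hx.ne'] using hbn x hx
        have hp₃ : IsProperOn G L Z (Function.update (Function.update e' u b) v a) := by
          refine ⟨fun x => ?_, fun x hx y hy hxy => ?_⟩
          · by_cases hxu : x = u
            · subst hxu; rwa [hu₃]
            · rw [heq₃ x hxu]; exact hp₁.1 x
          · by_cases hxu : x = u
            · subst hxu; rw [hu₃]; exact (hbn₃ y hxy).symm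
            · by_cases hyu : y = u
              · subst hyu; rw [hu₃]; exact hbn₃ x hxy.symm
              · rw [heq₃ x hxu, heq₃ y hyu]
                exact hp₁.2 x ⟨hx, hxu⟩ y ⟨hy, hyu⟩ hxy
        exact ⟨_, (hr.tail ⟨hp₂, u, Finset.mem_insert_self _ _, b, rfl⟩).tail
          ⟨hp₃, v, Finset.mem_insert_of_mem hv, a, rfl⟩, hp₃, heq₃⟩
    -- The induction hypothesis aims at `d` with `u` left at `c u`; a last move then gives `u` its
    -- color `d u`.
    have hd' : IsProperOn G L (Z \ {u}) (Function.update d u (c u)) := by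
      refine ⟨fun v => ?_, fun x hx y hy hxy => ?_⟩
      · by_cases hv : v = u
        · subst hv; simpa using hc.1 v
        · simpa [hv] using hd.1 v
      · rw [Function.update_of_ne hx.2, Function.update_of_ne hy.2]
        exact hd.2 x hx.1 y hy.1 hxy
    obtain ⟨e, hr, -, heq⟩ := hlift _ (ih (Z \ {u}) c (Function.update d u (c u))
      (hc.mono Set.sdiff_subset) hd' fun v hv => by
        by_cases hvu : v = u
        · subst hvu; simp
        · rw [Function.update_of_ne hvu]
          exact hcd v fun h => (Finset.mem_insert.1 h).elim hvu hv)
    refine hr.tail ⟨hd, u, Finset.mem_insert_self _ _, d u, ?_⟩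
    funext v
    by_cases hvu : v = u
    · subst hvu; simp
    · rw [Function.update_of_ne hvu, heq v hvu, Function.update_of_ne hvu]

end Recoloring

/-! ### Cauchy–Schwarz along paths -/

section PathSum

variable {Ω : Type*} {H : SimpleGraph Ω}

/-- Telescoping and Cauchy–Schwarz, with each edge charged to its starting vertex. -/
theorem SimpleGraph.Walk.sq_sub_le_length_mul_sum {u v : Ω} (p : H.Walk u v) (f F : Ω → ℝ)
    (hF : ∀ a b, H.Adj a b → (f a - f b) ^ 2 ≤ F a) :
    0 ≤ ((p.darts.map (·.fst)).map F).sum ∧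
      (f u - f v) ^ 2 ≤ p.length * ((p.darts.map (·.fst)).map F).sum := by
  induction p with
  | nil => simp
  | @cons a b c h p ih =>
    simp only [SimpleGraph.Walk.darts_cons, List.map_cons, List.sum_cons,
      SimpleGraph.Walk.length_cons, Nat.cast_add, Nat.cast_one]
    obtain ⟨h0, h1⟩ := ih
    set S := ((p.darts.map (·.fst)).map F).sum
    have ha := hF a b h
    have hsq := sq_nonneg (f a - f b)
    refine ⟨by linarith, ?_⟩
    have hl : (0 : ℝ) ≤ p.length := Nat.cast_nonneg _
    generalize (p.length : ℝ) = l at *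
    have hle : (f a - f c) ^ 2 ≤ (l + 1) * ((f a - f b) ^ 2 + S) := by
      have e : f a - f c = (f a - f b) + (f b - f c) := by ring
      rw [e]
      generalize f a - f b = x at *
      generalize f b - f c = y at *
      rcases hl.eq_or_lt with rfl | hl
      · have hy : y = 0 := by
          have : y ^ 2 ≤ 0 := by simpa using h1
          exact pow_eq_zero_iff (two_ne_zero) |>.1 (le_antisymm this (sq_nonneg y))
        subst hy
        nlinarith
      -- This is `2 * x * y ≤ l * x ^ 2 + y ^ 2 / l` cleared of its denominator, with `y ^ 2 ≤ l *
      -- S`.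
      · have h2 : l * (2 * x * y) ≤ l * (l * x ^ 2 + S) := by nlinarith [sq_nonneg (l * x - y)]
        have h3 := le_of_mul_le_mul_left h2 hl
        nlinarith
    refine hle.trans (mul_le_mul_of_nonneg_left (by linarith) (by linarith))

theorem SimpleGraph.Walk.IsPath.sq_sub_le_card_mul_sum {u v : Ω} {p : H.Walk u v}
    (hp : p.IsPath) (f F : Ω → ℝ) (hF0 : ∀ a, 0 ≤ F a)
    (hF : ∀ a b, H.Adj a b → (f a - f b) ^ 2 ≤ F a) (C : Finset Ω) (hC : ∀ x ∈ p.support, x ∈ C) :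
    (f u - f v) ^ 2 ≤ C.card * ∑ a ∈ C, F a := by
  classical
  obtain ⟨-, h⟩ := p.sq_sub_le_length_mul_sum f F hF
  refine h.trans ?_
  have hsub : (p.darts.map (·.fst)).Sublist p.support := by
    rw [SimpleGraph.Walk.map_fst_darts]; exact List.dropLast_sublist _
  have hnd : (p.darts.map (·.fst)).Nodup := hp.support_nodup.sublist hsub
  have hlen : (p.length : ℝ) ≤ C.card := by
    have h1 : (p.darts.map (·.fst)).toFinset.card = p.length := by
      rw [List.toFinset_card_of_nodup hnd]; simp
    rw [← h1]
    exact_mod_cast Finset.card_le_card fun x hx => hC x (hsub.subset (List.mem_toFinset.1 hx))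
  have hsum : ((p.darts.map (·.fst)).map F).sum ≤ ∑ a ∈ C, F a := by
    rw [← List.sum_toFinset F hnd]
    exact Finset.sum_le_sum_of_subset_of_nonneg
      (fun x hx => hC x (hsub.subset (List.mem_toFinset.1 hx))) fun a _ _ => hF0 a
  calc (p.length : ℝ) * ((p.darts.map (·.fst)).map F).sum
      ≤ p.length * ∑ a ∈ C, F a := mul_le_mul_of_nonneg_left hsum (Nat.cast_nonneg _)
    _ ≤ C.card * ∑ a ∈ C, F a :=
        mul_le_mul_of_nonneg_right hlen (Finset.sum_nonneg fun a _ => hF0 a)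

end PathSum

/-! ### Canonical paths and the Poincaré inequality -/

section CanonicalPaths

open scoped Classical

variable {V α : Type*} {G : SimpleGraph V} {L : V → Finset α}

/-- The color of a vertex in a list coloring. -/
def ListColoring.color (σ : ListColoring G L) (v : V) : α := (σ.1 v : α)

theorem ListColoring.color_injective :
    Function.Injective (ListColoring.color : ListColoring G L → V → α) := fun _ _ h =>
  Subtype.ext (funext fun v => Subtype.ext (congrFun h v))

theorem ListColoring.isProperOn_color (σ : ListColoring G L) :
    IsProperOn G L Set.univ σ.color :=
  ⟨fun v => (σ.1 v).2, fun u _ v _ h => σ.2 u v h⟩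

theorem IsProperOn.exists_listColoring {c : V → α} (h : IsProperOn G L Set.univ c) :
    ∃ σ : ListColoring G L, σ.color = c :=
  ⟨⟨fun v => ⟨c v, h.1 v⟩, fun u v huv => h.2 u trivial v trivial huv⟩, rfl⟩

theorem card_pi_lists_le {q : ℕ} (hq : ∀ v, (L v).card ≤ q) (W : Finset V) :
    Fintype.card ((v : W) → L v) ≤ q ^ W.card := by
  rw [Fintype.card_pi]
  calc ∏ v : W, Fintype.card (L v) ≤ ∏ _v : W, q :=
        Finset.prod_le_prod' fun v _ => by simpa using hq v
    _ = q ^ W.card := by simp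

variable [Fintype V]

theorem mem_agreeOff {v : V} {σ τ : ListColoring G L} :
    τ ∈ agreeOff G L v σ ↔ ∀ u, u ≠ v → τ.color u = σ.color u := by
  simp only [agreeOff, Set.Finite.mem_toFinset, Set.mem_ofPred_eq]
  exact forall₂_congr fun u _ => Subtype.ext_iff

/-- The list colorings that agree with `σ` outside `W`. -/
noncomputable def agreeOutside (W : Finset V) (σ : ListColoring G L) :
    Finset (ListColoring G L) :=
  Finset.univ.filter fun τ => ∀ u ∉ W, τ.color u = σ.color u

theorem mem_agreeOutside {W : Finset V} {σ τ : ListColoring G L} :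
    τ ∈ agreeOutside W σ ↔ ∀ u ∉ W, τ.color u = σ.color u := by
  simp [agreeOutside]

theorem agreeOutside_singleton (v : V) (σ : ListColoring G L) :
    agreeOutside {v} σ = agreeOff G L v σ := by
  ext τ
  simp [mem_agreeOutside, mem_agreeOff]

theorem card_agreeOutside_le {q : ℕ} (hq : ∀ v, (L v).card ≤ q) (W : Finset V)
    (σ : ListColoring G L) : (agreeOutside W σ).card ≤ q ^ W.card := by
  refine le_trans ?_ (card_pi_lists_le hq W)
  rw [← Finset.card_univ]
  refine Finset.card_le_card_of_injOn (fun τ (v : W) => τ.1 v) (fun _ _ => Finset.mem_univ _) ?_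
  intro τ hτ ρ hρ h
  rw [Finset.mem_coe, mem_agreeOutside] at hτ hρ
  refine ListColoring.color_injective (funext fun v => ?_)
  by_cases hv : v ∈ W
  · exact congrArg Subtype.val (congrFun h ⟨v, hv⟩)
  · rw [hτ v hv, hρ v hv]

/-- The sum of the squared differences of `f` over the single-site moves from `σ`. -/
noncomputable def siteEnergy (f : ListColoring G L → ℝ) (σ : ListColoring G L) : ℝ :=
  ∑ v : V, ∑ τ ∈ agreeOff G L v σ, (f σ - f τ) ^ 2

theorem siteEnergy_nonneg (f : ListColoring G L → ℝ) (σ : ListColoring G L) :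
    0 ≤ siteEnergy f σ :=
  Finset.sum_nonneg fun _ _ => Finset.sum_nonneg fun _ _ => sq_nonneg _

theorem sq_sub_le_siteEnergy (f : ListColoring G L → ℝ) {v : V} {σ τ : ListColoring G L}
    (h : τ ∈ agreeOff G L v σ) : (f σ - f τ) ^ 2 ≤ siteEnergy f σ :=
  (Finset.single_le_sum (f := fun τ => (f σ - f τ) ^ 2) (fun _ _ => sq_nonneg _) h).trans
    (Finset.single_le_sum (f := fun v => ∑ τ ∈ agreeOff G L v σ, (f σ - f τ) ^ 2)
      (fun _ _ => Finset.sum_nonneg fun _ _ => sq_nonneg _) (Finset.mem_univ v))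

/-- If `η` and `η'` take opposite colors from `σ` and `τ` outside `W`, then `η`, `η'` and the
restrictions to `W` determine the pair. -/
theorem card_pairs_le {q : ℕ} (hq : ∀ v, (L v).card ≤ q) (W : Finset V)
    (m : ListColoring G L → ListColoring G L → ListColoring G L) (ρ : ListColoring G L)
    (hm : ∀ v ∉ W, (∀ σ τ, (m σ τ).color v = τ.color v) ∨ ∀ σ τ, (m σ τ).color v = σ.color v) :
    (Finset.univ.filter fun x : ListColoring G L × ListColoring G L =>
      ρ ∈ agreeOutside W (m x.1 x.2)).card ≤
      Fintype.card (ListColoring G L) * (q ^ W.card * q ^ W.card) := by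
  refine le_trans ?_ (Nat.mul_le_mul_left _
    (Nat.mul_le_mul (card_pi_lists_le hq W) (card_pi_lists_le hq W)))
  rw [← Fintype.card_prod, ← Fintype.card_prod, ← Finset.card_univ]
  refine Finset.card_le_card_of_injOn
    (fun x => (m x.2 x.1, (fun v : W => x.1.1 v), fun v : W => x.2.1 v))
    (fun _ _ => Finset.mem_univ _) ?_
  rintro ⟨σ, τ⟩ hx ⟨σ', τ'⟩ hx' h
  rw [Finset.mem_coe, Finset.mem_filter, mem_agreeOutside] at hx hx'
  simp only [Prod.mk.injEq] at h
  obtain ⟨h1, h2, h3⟩ := h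
  have key : ∀ v, σ.color v = σ'.color v ∧ τ.color v = τ'.color v := by
    intro v
    by_cases hv : v ∈ W
    · exact ⟨congrArg Subtype.val (congrFun h2 ⟨v, hv⟩),
        congrArg Subtype.val (congrFun h3 ⟨v, hv⟩)⟩
    · have h4 := (hx.2 v hv).symm.trans (hx'.2 v hv)
      have h5 : (m τ σ).color v = (m τ' σ').color v := by rw [h1]
      rcases hm v hv with hm | hm
      · simp only [hm] at h4 h5
        exact ⟨h5, h4⟩
      · simp only [hm] at h4 h5
        exact ⟨h4, h5⟩
  exact Prod.ext (ListColoring.color_injective (funext fun v => (key v).1))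
    (ListColoring.color_injective (funext fun v => (key v).2))

variable (G L) in
/-- The graph of moves that change the color of one vertex of `W`. -/
def recolorGraph (W : Finset V) : SimpleGraph (ListColoring G L) where
  Adj σ τ := σ ≠ τ ∧ ∃ v ∈ W, τ ∈ agreeOff G L v σ
  symm := ⟨fun σ τ ⟨h, v, hv, hm⟩ => ⟨h.symm, v, hv, by
    rw [mem_agreeOff] at hm ⊢
    exact fun u hu => (hm u hu).symm⟩⟩
  loopless := ⟨fun _ h => h.1 rfl⟩

theorem mem_agreeOutside_of_mem_support {W : Finset V} {σ τ ρ : ListColoring G L}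
    (p : (recolorGraph G L W).Walk σ τ) (h : ρ ∈ p.support) : ρ ∈ agreeOutside W σ := by
  induction p with
  | nil =>
    rw [SimpleGraph.Walk.mem_support_nil_iff] at h
    subst h
    exact mem_agreeOutside.2 fun _ _ => rfl
  | @cons a b c hab p ih =>
    rw [SimpleGraph.Walk.support_cons, List.mem_cons] at h
    rcases h with rfl | h
    · exact mem_agreeOutside.2 fun _ _ => rfl
    · obtain ⟨-, v, hv, hm⟩ := hab
      have := mem_agreeOutside.1 (ih h)
      refine mem_agreeOutside.2 fun u hu => (this u hu).trans (mem_agreeOff.1 hm u ?_)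
      rintro rfl
      exact hu hv

variable [DecidableRel G.Adj]

theorem reachable_recolorGraph (hL : ∀ v, G.degree v + 2 ≤ (L v).card) {W : Finset V}
    {σ τ : ListColoring G L} (h : τ ∈ agreeOutside W σ) : (recolorGraph G L W).Reachable σ τ := by
  rw [mem_agreeOutside] at h
  have hr := IsProperOn.reflTransGen_recolorStep hL W Set.univ σ.color τ.color
    σ.isProperOn_color τ.isProperOn_color fun v hv => (h v hv).symm
  have key : ∀ c, Relation.ReflTransGen (RecolorStep G L Set.univ W) σ.color c →
      ∃ ρ : ListColoring G L, ρ.color = c ∧ (recolorGraph G L W).Reachable σ ρ := by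
    intro c hc
    induction hc with
    | refl => exact ⟨σ, rfl, .refl _⟩
    | @tail c d _ hstep ih =>
      obtain ⟨ρ, rfl, hρ⟩ := ih
      obtain ⟨hd, v, hv, a, hda⟩ := hstep
      obtain ⟨η, rfl⟩ := hd.exists_listColoring
      refine ⟨η, rfl, ?_⟩
      by_cases hne : ρ = η
      · exact hne ▸ hρ
      · refine hρ.trans (SimpleGraph.Adj.reachable ⟨hne, v, hv, ?_⟩)
        rw [mem_agreeOff]
        intro u hu
        rw [hda, Function.update_of_ne hu]
  obtain ⟨ρ, hρ, hσρ⟩ := key _ hr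
  rwa [← ListColoring.color_injective hρ]

/-- No explicit route is needed: a simple path inside the block visits each of its colorings at most
once. -/
theorem sq_sub_le_sum_siteEnergy (hL : ∀ v, G.degree v + 2 ≤ (L v).card) {W : Finset V}
    {σ τ : ListColoring G L} (h : τ ∈ agreeOutside W σ) (f : ListColoring G L → ℝ) :
    (f σ - f τ) ^ 2 ≤ (agreeOutside W σ).card * ∑ ρ ∈ agreeOutside W σ, siteEnergy f ρ := by
  obtain ⟨p, hp⟩ := (reachable_recolorGraph hL h).exists_isPath
  exact hp.sq_sub_le_card_mul_sum f _ (siteEnergy_nonneg f)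
    (fun a b ⟨_, _, _, hm⟩ => sq_sub_le_siteEnergy f hm) _
    fun ρ hρ => mem_agreeOutside_of_mem_support p hρ

/-- Two colorings can be combined along a separation. -/
theorem exists_hybrid (hL : ∀ v, G.degree v + 2 ≤ (L v).card) {A R : Set V}
    (hd : Disjoint A R) (hAR : ∀ a ∈ A, ∀ r ∈ R, ¬ G.Adj a r) (σ τ : ListColoring G L) :
    ∃ η : ListColoring G L, (∀ v ∈ A, η.color v = τ.color v) ∧
      ∀ v ∈ R, η.color v = σ.color v := by
  have hdis : ∀ v ∈ R, v ∉ A := fun v hv hv' => Set.disjoint_left.1 hd hv' hv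
  obtain ⟨d, hd, hdc⟩ := IsProperOn.exists_extension hL
    (Finset.univ.filter fun v => v ∉ A ∧ v ∉ R) (fun v => if v ∈ A then τ.color v else σ.color v)
    ⟨fun v => by
      dsimp only
      split_ifs
      · exact τ.isProperOn_color.1 v
      · exact σ.isProperOn_color.1 v, fun u hu v hv huv => by
      simp only [Finset.mem_filter, Finset.mem_univ, true_and, Set.mem_ofPred_eq,
        not_and_or, not_not] at hu hv
      by_cases hua : u ∈ A <;> by_cases hva : v ∈ A
      · simpa [hua, hva] using τ.isProperOn_color.2 u trivial v trivial huv
      · exact absurd huv (hAR u hua v (hv.resolve_left hva))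
      · exact absurd huv.symm (hAR v hva u (hu.resolve_left hua))
      · simpa [hua, hva] using σ.isProperOn_color.2 u trivial v trivial huv⟩
  obtain ⟨η, rfl⟩ := hd.exists_listColoring
  refine ⟨η, fun v hv => ?_, fun v hv => ?_⟩
  · rw [hdc v (by simp [hv]), if_pos hv]
  · rw [hdc v (by simp [hv]), if_neg (hdis v hv)]

/-- A Poincaré inequality from canonical paths along a sequence of separations `(A i, R i)`. -/
theorem sum_sq_sub_le_of_separations (hL : ∀ v, G.degree v + 2 ≤ (L v).card) {q : ℕ}
    (hq0 : 1 ≤ q) (hq : ∀ v, (L v).card ≤ q) (n w : ℕ) (A R : ℕ → Set V) (W : ℕ → Finset V)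
    (hd : ∀ i, Disjoint (A i) (R i)) (hAR : ∀ i, ∀ a ∈ A i, ∀ r ∈ R i, ¬ G.Adj a r)
    (h0 : ∀ v, v ∈ R 0) (hn : ∀ v, v ∈ A n)
    (hW : ∀ i < n, ∀ v ∉ W i, (v ∈ A i ∧ v ∈ A (i + 1)) ∨ (v ∈ R i ∧ v ∈ R (i + 1)))
    (hw : ∀ i < n, (W i).card ≤ w) (f : ListColoring G L → ℝ) :
    ∑ σ, ∑ τ, (f σ - f τ) ^ 2 ≤
      Fintype.card (ListColoring G L) * (n ^ 2 * q ^ (3 * w)) * ∑ ρ, siteEnergy f ρ := by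
  choose m hmA hmR using fun i σ τ => exists_hybrid hL (hd i) (hAR i) σ τ
  have hm0 : ∀ σ τ, m 0 σ τ = σ := fun σ τ =>
    ListColoring.color_injective (funext fun v => hmR 0 σ τ v (h0 v))
  have hmn : ∀ σ τ, m n σ τ = τ := fun σ τ =>
    ListColoring.color_injective (funext fun v => hmA n σ τ v (hn v))
  have hstep : ∀ i < n, ∀ σ τ, m (i + 1) σ τ ∈ agreeOutside (W i) (m i σ τ) := by
    intro i hi σ τ
    refine mem_agreeOutside.2 fun v hv => ?_
    rcases hW i hi v hv with ⟨h1, h2⟩ | ⟨h1, h2⟩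
    · rw [hmA _ _ _ v h1, hmA _ _ _ v h2]
    · rw [hmR _ _ _ v h1, hmR _ _ _ v h2]
  have hqw : ∀ i < n, q ^ (W i).card ≤ q ^ w := fun i hi => Nat.pow_le_pow_right hq0 (hw i hi)
  -- Cauchy–Schwarz over the `n` stages costs `n`; the path within a stage costs the block size, at
  -- most `q ^ w`.
  have hpair : ∀ σ τ, (f σ - f τ) ^ 2 ≤ n * ∑ i ∈ Finset.range n,
      (q : ℝ) ^ w * ∑ ρ, if ρ ∈ agreeOutside (W i) (m i σ τ) then siteEnergy f ρ else 0 := by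
    intro σ τ
    have htel : f τ - f σ = ∑ i ∈ Finset.range n, (f (m (i + 1) σ τ) - f (m i σ τ)) := by
      rw [Finset.sum_range_sub (fun i => f (m i σ τ)), hm0, hmn]
    have hsq : (f σ - f τ) ^ 2 = (f τ - f σ) ^ 2 := by ring
    rw [hsq, htel]
    have hcs := sq_sum_le_card_mul_sum_sq (s := Finset.range n)
      (f := fun i => f (m (i + 1) σ τ) - f (m i σ τ))
    rw [Finset.card_range] at hcs
    refine hcs.trans (mul_le_mul_of_nonneg_left (Finset.sum_le_sum fun i hi => ?_)
      (Nat.cast_nonneg n))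
    have hi' := Finset.mem_range.1 hi
    have h1 := sq_sub_le_sum_siteEnergy hL (hstep i hi' σ τ) f
    rw [← Finset.sum_filter, Finset.filter_mem_eq_inter, Finset.univ_inter]
    have h2 : ((agreeOutside (W i) (m i σ τ)).card : ℝ) ≤ (q : ℝ) ^ w := by
      exact_mod_cast (card_agreeOutside_le hq (W i) (m i σ τ)).trans (hqw i hi')
    have h3 : 0 ≤ ∑ ρ ∈ agreeOutside (W i) (m i σ τ), siteEnergy f ρ :=
      Finset.sum_nonneg fun ρ _ => siteEnergy_nonneg f ρ
    calc (f (m (i + 1) σ τ) - f (m i σ τ)) ^ 2 = (f (m i σ τ) - f (m (i + 1) σ τ)) ^ 2 := by ring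
      _ ≤ _ := h1
      _ ≤ _ := mul_le_mul_of_nonneg_right h2 h3
  -- Congestion: at each stage a coloring is charged by at most `N * q ^ (2 * w)` pairs, with `N`
  -- the number of colorings.
  have hcount : ∀ i ∈ Finset.range n,
      ∑ σ, ∑ τ, ∑ ρ, (if ρ ∈ agreeOutside (W i) (m i σ τ) then siteEnergy f ρ else 0) ≤
        Fintype.card (ListColoring G L) * ((q : ℝ) ^ w * q ^ w) * ∑ ρ, siteEnergy f ρ := by
    intro i hi
    have hi' := Finset.mem_range.1 hi
    rw [← Fintype.sum_prod_type' (f := fun σ τ => ∑ ρ,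
      (if ρ ∈ agreeOutside (W i) (m i σ τ) then siteEnergy f ρ else 0)), Finset.sum_comm,
      Finset.mul_sum]
    refine Finset.sum_le_sum fun ρ _ => ?_
    rw [← Finset.sum_filter, Finset.sum_const, nsmul_eq_mul]
    refine mul_le_mul_of_nonneg_right ?_ (siteEnergy_nonneg f ρ)
    have h1 := card_pairs_le hq (W i) (m i) ρ fun v hv =>
      (hW i hi' v hv).imp (fun h σ τ => hmA i σ τ v h.1) fun h σ τ => hmR i σ τ v h.1
    have h2 := h1.trans (Nat.mul_le_mul_left _ (Nat.mul_le_mul (hqw i hi') (hqw i hi')))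
    exact_mod_cast h2
  calc ∑ σ, ∑ τ, (f σ - f τ) ^ 2
      ≤ ∑ σ, ∑ τ, n * ∑ i ∈ Finset.range n, (q : ℝ) ^ w *
          ∑ ρ, (if ρ ∈ agreeOutside (W i) (m i σ τ) then siteEnergy f ρ else 0) :=
        Finset.sum_le_sum fun σ _ => Finset.sum_le_sum fun τ _ => hpair σ τ
    _ = n * (q : ℝ) ^ w * ∑ i ∈ Finset.range n, ∑ σ, ∑ τ,
          ∑ ρ, (if ρ ∈ agreeOutside (W i) (m i σ τ) then siteEnergy f ρ else 0) := by
        simp only [← Finset.mul_sum]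
        rw [mul_assoc]
        congr 1
        simp only [Finset.mul_sum]
        symm
        rw [Finset.sum_comm]
        refine Finset.sum_congr rfl fun σ _ => ?_
        rw [Finset.sum_comm]
    _ ≤ n * (q : ℝ) ^ w * ∑ _i ∈ Finset.range n, (Fintype.card (ListColoring G L) *
          ((q : ℝ) ^ w * q ^ w) * ∑ ρ, siteEnergy f ρ) :=
        mul_le_mul_of_nonneg_left (Finset.sum_le_sum hcount) (by positivity)
    _ = _ := by
        rw [Finset.sum_const, Finset.card_range, nsmul_eq_mul]
        ring

theorem HasLayout.sum_sq_sub_le (hL : ∀ v, G.degree v + 2 ≤ (L v).card) {q : ℕ}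
    (hq0 : 1 ≤ q) (hq : ∀ v, (L v).card ≤ q) {w : ℕ} (h : HasLayout G Finset.univ w)
    (f : ListColoring G L → ℝ) :
    ∑ σ, ∑ τ, (f σ - f τ) ^ 2 ≤ Fintype.card (ListColoring G L) *
      (Fintype.card V ^ 2 * q ^ (3 * (w + 1))) * ∑ ρ, siteEnergy f ρ := by
  obtain ⟨l, hl, hmem, hw⟩ := h
  have hmem' : ∀ v, v ∈ l := fun v => (hmem v).2 (Finset.mem_univ v)
  have hlen : l.length = Fintype.card V := by
    rw [← List.toFinset_card_of_nodup hl, ← Finset.card_univ]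
    congr 1
    ext v
    simp [hmem' v]
  have hsplit : ∀ i v, v ∈ l.take i ∨ v ∈ l.drop i := fun i v => by
    rw [← List.mem_append, List.take_append_drop]; exact hmem' v
  refine sum_sq_sub_le_of_separations hL hq0 hq (Fintype.card V) (w + 1)
    -- Besides the boundary, `W i` contains the vertex that leaves the unprocessed part at stage
    -- `i`; hence `w + 1`.
    (fun i => {v | v ∈ l.take i ∧ ∀ y ∈ l.drop i, ¬ G.Adj v y}) (fun i => {v | v ∈ l.drop i})
    (fun i => listBoundary G (l.take i) (l.drop i) ∪ (l[i]?).toFinset)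
    ?_ ?_ ?_ ?_ ?_ ?_ f
  · intro i
    rw [Set.disjoint_left]
    intro v hv hv'
    exact List.disjoint_take_drop hl le_rfl hv.1 hv'
  · exact fun i a ha r hr => ha.2 r hr
  · intro v; simpa using hmem' v
  · intro v
    rw [← hlen]
    simpa using hmem' v
  · intro i hi v hv
    rw [← hlen] at hi
    rw [List.getElem?_eq_getElem hi, Finset.mem_union, mem_listBoundary, not_or] at hv
    simp only [Option.toFinset_some, Finset.mem_singleton] at hv
    have hdrop : l.drop i = l[i] :: l.drop (i + 1) := (List.getElem_cons_drop hi).symm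
    obtain ⟨hv1, hv2⟩ := hv
    rcases hsplit i v with h1 | h1
    · left
      have h2 : ∀ y ∈ l.drop i, ¬ G.Adj v y := fun y hy hvy => hv1 ⟨h1, y, hy, hvy⟩
      refine ⟨⟨h1, h2⟩, ⟨?_, fun y hy => h2 y ?_⟩⟩
      · exact (List.take_subset_take_left l (Nat.le_succ i)) h1
      · rw [hdrop]; exact List.mem_cons_of_mem _ hy
    · right
      refine ⟨h1, ?_⟩
      have h1' := h1
      rw [hdrop, List.mem_cons] at h1'
      exact h1'.resolve_left hv2
  · intro i _
    refine (Finset.card_union_le _ _).trans (Nat.add_le_add ?_ ?_)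
    · exact hw _ _ (List.take_append_drop i l).symm
    · cases l[i]? <;> simp

end CanonicalPaths

/-! ### `L²` decay for symmetric chains -/

section ReversibleChains

variable {Ω : Type*} [Fintype Ω] {M : Matrix Ω Ω ℝ}

theorem dirichlet_form_eq (hsymm : ∀ x y, M x y = M y x) (hrow : ∀ x, ∑ y, M x y = 1)
    (f : Ω → ℝ) :
    ∑ x, ∑ y, M x y * (f x - f y) ^ 2 = 2 * (∑ x, f x ^ 2 - ∑ x, f x * ∑ y, M x y * f y) := by
  have h1 : ∑ x, ∑ y, M x y * f x ^ 2 = ∑ x, f x ^ 2 := by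
    simp only [← Finset.sum_mul, hrow, one_mul]
  have h2 : ∑ x, ∑ y, M x y * f y ^ 2 = ∑ x, f x ^ 2 := by
    rw [Finset.sum_comm, ← h1]
    exact Finset.sum_congr rfl fun x _ => Finset.sum_congr rfl fun y _ => by rw [hsymm]
  have h3 : ∑ x, ∑ y, M x y * (f x - f y) ^ 2 = ∑ x, ∑ y, M x y * f x ^ 2 +
      ∑ x, ∑ y, M x y * f y ^ 2 - 2 * ∑ x, f x * ∑ y, M x y * f y := by
    simp only [Finset.mul_sum, ← Finset.sum_add_distrib, ← Finset.sum_sub_distrib]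
    exact Finset.sum_congr rfl fun x _ => Finset.sum_congr rfl fun y _ => by ring
  rw [h3, h1, h2]
  ring

theorem sum_sq_sub_eq (f : Ω → ℝ) (hf : ∑ x, f x = 0) :
    ∑ x, ∑ y, (f x - f y) ^ 2 = 2 * Fintype.card Ω * ∑ x, f x ^ 2 := by
  have h : ∀ x, ∑ y, (f x - f y) ^ 2 = Fintype.card Ω * f x ^ 2 + ∑ y, f y ^ 2 := by
    intro x
    have : ∀ y, (f x - f y) ^ 2 = f x ^ 2 + f y ^ 2 - 2 * f x * f y := fun y => by ring
    simp only [this, Finset.sum_sub_distrib, Finset.sum_add_distrib, ← Finset.mul_sum, hf]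
    simp
  simp only [h, Finset.sum_add_distrib, ← Finset.mul_sum]
  simp
  ring

/-- Geometric decay of the distance to the uniform distribution. -/
theorem tvDist_pow_le [DecidableEq Ω] (hsymm : ∀ x y, M x y = M y x)
    (hrow : ∀ x, ∑ y, M x y = 1) {r : ℝ} (hr : 0 ≤ r)
    (hM : ∀ f : Ω → ℝ, ∑ x, f x = 0 → ∑ x, (∑ y, M x y * f y) ^ 2 ≤ r * ∑ x, f x ^ 2)
    (x : Ω) (k : ℕ) :
    (2 * tvDist ((M ^ k) x) (fun _ => 1 / (Fintype.card Ω : ℝ))) ^ 2 ≤ Fintype.card Ω * r ^ k := by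
  have hN : (0 : ℝ) < Fintype.card Ω := by
    have : Nonempty Ω := ⟨x⟩
    exact_mod_cast Fintype.card_pos
  -- By symmetry the law of the chain evolves as a function under `M`, so `hM` applies to its
  -- mean-zero deviation from uniform.
  have hsucc : ∀ k y, (M ^ (k + 1)) x y = ∑ z, M y z * (M ^ k) x z := by
    intro k y
    rw [pow_succ, Matrix.mul_apply]
    exact Finset.sum_congr rfl fun z _ => by rw [hsymm y z, mul_comm]
  have hsum : ∀ k, ∑ y, (M ^ k) x y = 1 := by
    intro k
    induction k with
    | zero => simp [Matrix.one_apply]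
    | succ k ih =>
      simp only [hsucc]
      rw [Finset.sum_comm, ← ih]
      refine Finset.sum_congr rfl fun z _ => ?_
      rw [← Finset.sum_mul, Finset.sum_congr rfl fun y _ => hsymm y z, hrow, one_mul]
  have hzero : ∀ k, ∑ y, ((M ^ k) x y - 1 / (Fintype.card Ω : ℝ)) = 0 := by
    intro k
    rw [Finset.sum_sub_distrib, hsum, Finset.sum_const, Finset.card_univ, nsmul_eq_mul]
    field_simp
    ring
  have hdecay : ∀ k, ∑ y, ((M ^ k) x y - 1 / (Fintype.card Ω : ℝ)) ^ 2 ≤ r ^ k := by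
    intro k
    induction k with
    | zero =>
      have h1 : ∑ y, ((M ^ 0) x y - 1 / (Fintype.card Ω : ℝ)) ^ 2 =
          ∑ y, ((M ^ 0) x y) ^ 2 - 2 * (1 / (Fintype.card Ω : ℝ)) * ∑ y, (M ^ 0) x y +
            ∑ _y : Ω, (1 / (Fintype.card Ω : ℝ)) ^ 2 := by
        rw [Finset.mul_sum, ← Finset.sum_sub_distrib, ← Finset.sum_add_distrib]
        exact Finset.sum_congr rfl fun y _ => by ring
      have h2 : ∑ y, ((M ^ 0) x y) ^ 2 = 1 := by simp [Matrix.one_apply]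
      have h3 : ∑ _y : Ω, (1 / (Fintype.card Ω : ℝ)) ^ 2 = 1 / (Fintype.card Ω : ℝ) := by
        rw [Finset.sum_const, Finset.card_univ, nsmul_eq_mul]
        field_simp
      have h4 : 0 < 1 / (Fintype.card Ω : ℝ) := by positivity
      rw [h1, h2, h3, hsum, pow_zero]
      linarith
    | succ k ih =>
      have h1 : ∀ y, (M ^ (k + 1)) x y - 1 / (Fintype.card Ω : ℝ) =
          ∑ z, M y z * ((M ^ k) x z - 1 / (Fintype.card Ω : ℝ)) := by
        intro y
        simp only [mul_sub, Finset.sum_sub_distrib, ← Finset.sum_mul, hrow, hsucc, one_mul]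
      simp only [h1]
      refine (hM _ (hzero k)).trans ?_
      rw [pow_succ, mul_comm]
      exact mul_le_mul_of_nonneg_right ih hr
  have hcs := sq_sum_le_card_mul_sum_sq (s := Finset.univ)
    (f := fun y => |(M ^ k) x y - 1 / (Fintype.card Ω : ℝ)|)
  simp only [sq_abs, Finset.card_univ] at hcs
  have htv : 2 * tvDist ((M ^ k) x) (fun _ => 1 / (Fintype.card Ω : ℝ)) =
      ∑ y, |(M ^ k) x y - 1 / (Fintype.card Ω : ℝ)| := by
    unfold tvDist
    ring
  rw [htv]
  exact hcs.trans (mul_le_mul_of_nonneg_left (hdecay k) hN.le)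

end ReversibleChains

/-! ### Spectral gap and mixing of the Glauber dynamics -/

section GlauberDynamics

variable {V α : Type*} [Fintype V] {G : SimpleGraph V} {L : V → Finset α}

theorem self_mem_agreeOff (v : V) (σ : ListColoring G L) : σ ∈ agreeOff G L v σ :=
  mem_agreeOff.2 fun _ _ => rfl

theorem agreeOff_eq_of_mem {v : V} {σ τ : ListColoring G L} (h : τ ∈ agreeOff G L v σ) :
    agreeOff G L v τ = agreeOff G L v σ := by
  ext ρ
  rw [mem_agreeOff] at *
  rw [mem_agreeOff]
  exact forall₂_congr fun u hu => by rw [h u hu]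

theorem mem_agreeOff_comm {v : V} {σ τ : ListColoring G L} :
    τ ∈ agreeOff G L v σ ↔ σ ∈ agreeOff G L v τ := by
  simp only [mem_agreeOff]
  exact forall₂_congr fun _ _ => eq_comm

open Classical in
theorem siteUpdate_eq (v : V) (σ τ : ListColoring G L) : siteUpdate G L v σ τ =
    if τ ∈ agreeOff G L v σ then ((agreeOff G L v σ).card : ℝ)⁻¹ else 0 := by
  have hN : (Fintype.card (ListColoring G L) : ℝ) ≠ 0 := by
    have : Nonempty (ListColoring G L) := ⟨σ⟩
    exact_mod_cast Fintype.card_ne_zero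
  have hc : ((agreeOff G L v σ).card : ℝ) ≠ 0 := by
    exact_mod_cast (Finset.card_pos.2 ⟨σ, self_mem_agreeOff v σ⟩).ne'
  unfold siteUpdate uniformColoring
  congr 1
  rw [Finset.sum_const, nsmul_eq_mul]
  field_simp

theorem siteUpdate_symm (v : V) (σ τ : ListColoring G L) :
    siteUpdate G L v σ τ = siteUpdate G L v τ σ := by
  classical
  rw [siteUpdate_eq, siteUpdate_eq]
  by_cases h : τ ∈ agreeOff G L v σ
  · rw [if_pos h, if_pos (mem_agreeOff_comm.1 h), agreeOff_eq_of_mem h]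
  · rw [if_neg h, if_neg fun h' => h (mem_agreeOff_comm.1 h')]

theorem sum_siteUpdate (v : V) (σ : ListColoring G L) : ∑ τ, siteUpdate G L v σ τ = 1 := by
  classical
  have hc : ((agreeOff G L v σ).card : ℝ) ≠ 0 := by
    exact_mod_cast (Finset.card_pos.2 ⟨σ, self_mem_agreeOff v σ⟩).ne'
  simp only [siteUpdate_eq]
  rw [← Finset.sum_filter, Finset.filter_mem_eq_inter, Finset.univ_inter, Finset.sum_const,
    nsmul_eq_mul, mul_inv_cancel₀ hc]

/-- A site update is an orthogonal projection. -/
theorem sum_sq_siteUpdate (v : V) (f : ListColoring G L → ℝ) :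
    ∑ σ, (∑ τ, siteUpdate G L v σ τ * f τ) ^ 2 =
      ∑ σ, f σ * ∑ τ, siteUpdate G L v σ τ * f τ := by
  classical
  set g : ListColoring G L → ℝ := fun σ => ∑ τ, siteUpdate G L v σ τ * f τ with hg
  -- The update averages over classes of colorings agreeing off `v`, so `g` is constant on each
  -- class.
  have hconst : ∀ σ τ, siteUpdate G L v σ τ * g σ = siteUpdate G L v σ τ * g τ := by
    intro σ τ
    by_cases h : τ ∈ agreeOff G L v σ
    · congr 1
      simp only [hg, siteUpdate_eq, agreeOff_eq_of_mem h]
    · rw [siteUpdate_eq, if_neg h, zero_mul, zero_mul]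
  calc ∑ σ, g σ ^ 2 = ∑ σ, ∑ τ, f τ * (siteUpdate G L v σ τ * g σ) := by
        refine Finset.sum_congr rfl fun σ _ => ?_
        rw [sq]
        conv_lhs => enter [1]; rw [hg]
        rw [Finset.sum_mul]
        exact Finset.sum_congr rfl fun τ _ => by ring
    _ = ∑ τ, ∑ σ, f τ * (siteUpdate G L v σ τ * g τ) := by
        rw [Finset.sum_comm]
        exact Finset.sum_congr rfl fun τ _ => Finset.sum_congr rfl fun σ _ => by rw [hconst]
    _ = ∑ τ, f τ * g τ := by
        refine Finset.sum_congr rfl fun τ _ => ?_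
        rw [← Finset.mul_sum, ← Finset.sum_mul,
          Finset.sum_congr rfl fun σ _ => siteUpdate_symm v σ τ, sum_siteUpdate, one_mul]

theorem glauber_symm (σ τ : ListColoring G L) : glauber G L σ τ = glauber G L τ σ := by
  unfold glauber
  rw [Finset.sum_congr rfl fun v _ => siteUpdate_symm v σ τ]

theorem sum_glauber_mul (f : ListColoring G L → ℝ) (σ : ListColoring G L) :
    ∑ τ, glauber G L σ τ * f τ =
      (1 / (Fintype.card V : ℝ)) * ∑ v, ∑ τ, siteUpdate G L v σ τ * f τ := by
  unfold glauber
  rw [Finset.sum_comm, Finset.mul_sum]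
  refine Finset.sum_congr rfl fun τ _ => ?_
  rw [← Finset.sum_mul, mul_assoc]

theorem card_listColoring_le {q : ℕ} (hq : ∀ v, (L v).card ≤ q) :
    Fintype.card (ListColoring G L) ≤ q ^ Fintype.card V := by
  classical
  by_cases h : Nonempty (ListColoring G L)
  · obtain ⟨σ⟩ := h
    have h1 : agreeOutside Finset.univ σ = Finset.univ := by
      ext τ; simp [mem_agreeOutside]
    have h2 := card_agreeOutside_le hq Finset.univ σ
    rwa [h1, Finset.card_univ, Finset.card_univ] at h2
  · rw [not_nonempty_iff] at h
    rw [Fintype.card_eq_zero]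
    exact Nat.zero_le _

variable [Nonempty V]

theorem sum_glauber (σ : ListColoring G L) : ∑ τ, glauber G L σ τ = 1 := by
  unfold glauber
  rw [← Finset.mul_sum, Finset.sum_comm]
  simp [sum_siteUpdate]

/-- Jensen over the choice of vertex, then `sum_sq_siteUpdate`. This excludes negative eigenvalues,
so no lazy version of the chain is needed. -/
theorem sum_sq_glauber_le (f : ListColoring G L → ℝ) :
    ∑ σ, (∑ τ, glauber G L σ τ * f τ) ^ 2 ≤ ∑ σ, f σ * ∑ τ, glauber G L σ τ * f τ := by
  have hn : (0 : ℝ) < Fintype.card V := by exact_mod_cast Fintype.card_pos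
  simp only [sum_glauber_mul]
  have hcs : ∀ σ, ((1 / (Fintype.card V : ℝ)) * ∑ v, ∑ τ, siteUpdate G L v σ τ * f τ) ^ 2 ≤
      (1 / (Fintype.card V : ℝ)) * ∑ v, (∑ τ, siteUpdate G L v σ τ * f τ) ^ 2 := by
    intro σ
    have h := sq_sum_le_card_mul_sum_sq (s := Finset.univ)
      (f := fun v => ∑ τ, siteUpdate G L v σ τ * f τ)
    rw [Finset.card_univ] at h
    rw [mul_pow]
    calc _ ≤ (1 / (Fintype.card V : ℝ)) ^ 2 *
          (Fintype.card V * ∑ v, (∑ τ, siteUpdate G L v σ τ * f τ) ^ 2) :=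
          mul_le_mul_of_nonneg_left h (by positivity)
      _ = _ := by field_simp
  refine (Finset.sum_le_sum fun σ _ => hcs σ).trans_eq ?_
  rw [← Finset.mul_sum, Finset.sum_comm]
  simp only [sum_sq_siteUpdate]
  rw [Finset.sum_comm, Finset.mul_sum]
  refine Finset.sum_congr rfl fun σ _ => ?_
  rw [← Finset.mul_sum]
  ring

/-- A given vertex is chosen with probability `1 / n`, and each color available there then has
probability at least `1 / q`. -/
theorem sum_siteEnergy_le {q : ℕ} (hq0 : 1 ≤ q) (hq : ∀ v, (L v).card ≤ q)
    (f : ListColoring G L → ℝ) :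
    ∑ σ, siteEnergy f σ ≤
      Fintype.card V * q * ∑ σ, ∑ τ, glauber G L σ τ * (f σ - f τ) ^ 2 := by
  classical
  have hn : (0 : ℝ) < Fintype.card V := by exact_mod_cast Fintype.card_pos
  rw [Finset.mul_sum]
  refine Finset.sum_le_sum fun σ _ => ?_
  rw [sum_glauber_mul (fun τ => (f σ - f τ) ^ 2)]
  have h : Fintype.card V * (q : ℝ) * (1 / (Fintype.card V : ℝ) *
      ∑ v, ∑ τ, siteUpdate G L v σ τ * (f σ - f τ) ^ 2) =
      ∑ v, ∑ τ, q * (siteUpdate G L v σ τ * (f σ - f τ) ^ 2) := by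
    simp only [← Finset.mul_sum]
    field_simp
  rw [h]
  refine Finset.sum_le_sum fun v _ => ?_
  rw [← Finset.univ_inter (agreeOff G L v σ), ← Finset.filter_mem_eq_inter, Finset.sum_filter]
  refine Finset.sum_le_sum fun τ _ => ?_
  rw [siteUpdate_eq]
  split_ifs with hτ
  · have h1 : ((agreeOff G L v σ).card : ℝ) ≤ q := by
      have := card_agreeOutside_le hq {v} σ
      rw [agreeOutside_singleton, Finset.card_singleton, pow_one] at this
      exact_mod_cast this
    have h2 : (0 : ℝ) < (agreeOff G L v σ).card := by
      exact_mod_cast Finset.card_pos.2 ⟨σ, self_mem_agreeOff v σ⟩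
    have h3 : 1 ≤ q * ((agreeOff G L v σ).card : ℝ)⁻¹ := by
      rw [← div_eq_mul_inv, le_div_iff₀ h2, one_mul]
      exact h1
    rw [← mul_assoc]
    exact le_mul_of_one_le_left (sq_nonneg _) h3
  · simp

/-- Contraction of the Glauber dynamics on mean-zero functions under a bound on the vertex
separation number. -/
theorem HasLayout.sum_sq_glauber_le [DecidableRel G.Adj]
    (hL : ∀ v, G.degree v + 2 ≤ (L v).card) {q : ℕ} (hq0 : 1 ≤ q) (hq : ∀ v, (L v).card ≤ q)
    {w : ℕ} (h : HasLayout G Finset.univ w) (f : ListColoring G L → ℝ) (hf : ∑ σ, f σ = 0) :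
    ∑ σ, (∑ τ, glauber G L σ τ * f τ) ^ 2 ≤
      (1 - 1 / ((Fintype.card V : ℝ) ^ 3 * (q : ℝ) ^ (3 * (w + 1) + 1))) * ∑ σ, f σ ^ 2 := by
  refine (_root_.sum_sq_glauber_le f).trans ?_
  have hn : (0 : ℝ) < Fintype.card V := by exact_mod_cast Fintype.card_pos
  have hq' : (0 : ℝ) < q := by exact_mod_cast hq0
  rcases isEmpty_or_nonempty (ListColoring G L) with he | he
  · simp
  have hN : (0 : ℝ) < Fintype.card (ListColoring G L) := by exact_mod_cast Fintype.card_pos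
  have h1 := h.sum_sq_sub_le hL hq0 hq f
  rw [sum_sq_sub_eq f hf] at h1
  have h2 := sum_siteEnergy_le hq0 hq f
  rw [dirichlet_form_eq glauber_symm sum_glauber] at h2
  generalize ∑ σ, f σ * ∑ τ, glauber G L σ τ * f τ = P at *
  generalize ∑ σ, f σ ^ 2 = S at *
  generalize ∑ σ, siteEnergy f σ = D at *
  generalize (Fintype.card (ListColoring G L) : ℝ) = N at *
  generalize (Fintype.card V : ℝ) = n at *
  generalize (q : ℝ) = q at *
  have h3 : 2 * N * S ≤ 2 * N * ((n ^ 3 * q ^ (3 * (w + 1) + 1)) * (S - P)) := by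
    calc 2 * N * S ≤ N * (n ^ 2 * q ^ (3 * (w + 1))) * D := h1
      _ ≤ N * (n ^ 2 * q ^ (3 * (w + 1))) * (n * q * (2 * (S - P))) :=
          mul_le_mul_of_nonneg_left h2 (by positivity)
      _ = _ := by ring
  have h4 := le_of_mul_le_mul_left h3 (by positivity)
  have hA : 0 < n ^ 3 * q ^ (3 * (w + 1) + 1) := by positivity
  generalize n ^ 3 * q ^ (3 * (w + 1) + 1) = A at *
  have h5 : S / A ≤ S - P := by
    rw [div_le_iff₀ hA]; linarith
  have h6 : (1 - 1 / A) * S = S - S / A := by ring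
  rw [h6]
  linarith

/-- With `m = n * q`, the factor `(1 - 1 / A) ^ (2 * A * m) ≤ exp (-2 * m)` beats the number of
colorings, at most `q ^ n ≤ exp m`. What remains is `exp (-m) ≤ 1 / 4`, as `m ≥ 2`. -/
theorem HasLayout.tvDist_glauber_le [DecidableRel G.Adj]
    (hL : ∀ v, G.degree v + 2 ≤ (L v).card) {q : ℕ} (hq0 : 1 ≤ q) (hq : ∀ v, (L v).card ≤ q)
    {w : ℕ} (h : HasLayout G Finset.univ w) (hnq : 2 ≤ Fintype.card V * q)
    (σ : ListColoring G L) :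
    tvDist ((glauber G L ^
      (Fintype.card V ^ 3 * q ^ (3 * (w + 1) + 1) * (2 * (Fintype.card V * q)))) σ)
      (uniformColoring G L) ≤ 1 / 4 := by
  set A : ℕ := Fintype.card V ^ 3 * q ^ (3 * (w + 1) + 1) with hA
  have hA1 : 1 ≤ A := Nat.mul_pos (pow_pos Fintype.card_pos _) (pow_pos hq0 _)
  have hA1' : (1 : ℝ) ≤ A := by exact_mod_cast hA1
  have hr : (0 : ℝ) ≤ 1 - 1 / (A : ℝ) := by
    rw [sub_nonneg, div_le_one (by linarith)]
    exact hA1'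
  have hmain := tvDist_pow_le (M := glauber G L) glauber_symm sum_glauber hr (fun f hf => by
    have := h.sum_sq_glauber_le hL hq0 hq f hf
    rw [hA]
    push_cast
    exact this) σ (A * (2 * (Fintype.card V * q)))
  have hexp : (1 - 1 / (A : ℝ)) ^ (A * (2 * (Fintype.card V * q))) ≤
      Real.exp (-(Fintype.card V * q : ℕ)) ^ 2 := by
    have h1 : 1 - 1 / (A : ℝ) ≤ Real.exp (-(1 / (A : ℝ))) := by
      have := Real.add_one_le_exp (-(1 / (A : ℝ)))
      linarith
    refine (pow_le_pow_left₀ hr h1 _).trans_eq ?_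
    rw [← Real.exp_nat_mul, ← Real.exp_nat_mul]
    congr 1
    push_cast
    field_simp
  have hE : (0 : ℝ) < Real.exp (Fintype.card V * q : ℕ) := Real.exp_pos _
  have hcard : (Fintype.card (ListColoring G L) : ℝ) ≤ Real.exp (Fintype.card V * q : ℕ) := by
    have h1 : (Fintype.card (ListColoring G L) : ℝ) ≤ (q : ℝ) ^ Fintype.card V := by
      exact_mod_cast card_listColoring_le hq
    refine h1.trans ?_
    rw [Nat.cast_mul, Real.exp_nat_mul]
    refine pow_le_pow_left₀ (Nat.cast_nonneg _) ?_ _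
    have := Real.add_one_le_exp (q : ℝ)
    linarith
  have h4 : (4 : ℝ) ≤ Real.exp (Fintype.card V * q : ℕ) := by
    have h1 : Real.exp 2 ≤ Real.exp (Fintype.card V * q : ℕ) :=
      Real.exp_le_exp.2 (by exact_mod_cast hnq)
    have h2 : Real.exp 2 = Real.exp 1 ^ 2 := by rw [← Real.exp_nat_mul]; norm_num
    have h3 := Real.exp_one_gt_d9
    nlinarith
  have hfin : (Fintype.card (ListColoring G L) : ℝ) *
      (1 - 1 / (A : ℝ)) ^ (A * (2 * (Fintype.card V * q))) ≤ (1 / 2) ^ 2 := by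
    refine (mul_le_mul hcard hexp (pow_nonneg hr _) hE.le).trans ?_
    rw [Real.exp_neg]
    generalize Real.exp (Fintype.card V * q : ℕ) = E at *
    have : E * E⁻¹ ^ 2 = E⁻¹ := by field_simp
    rw [this]
    refine (inv_anti₀ (by norm_num) h4).trans_eq (by norm_num)
  have := abs_le_of_sq_le_sq' (hmain.trans hfin) (by norm_num)
  have hu : (fun _ => 1 / (Fintype.card (ListColoring G L) : ℝ)) = uniformColoring G L := rfl
  rw [hu] at this
  linarith [this.2]

end GlauberDynamics

/-! ### Numerical estimate and conclusion -/

/-- Compare logarithms: the power of `q` is `O(t * log n)`, and `Δ` only serves to absorb the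
factors of `n`, through `t * Δ ≥ 3`. The constant `30` is generous. -/
theorem natCast_le_rpow_of_treewidth_bound {n t q Δ : ℕ} (hn : 4 ≤ n) (ht : 1 ≤ t) (hq : 1 ≤ q)
    (hΔ : 3 ≤ Δ) :
    ((n ^ 3 * q ^ (3 * ((t + 1) * (Nat.log 2 n + 1) + 1) + 1) * (2 * (n * q)) : ℕ) : ℝ) ≤
      (n : ℝ) ^ ((30 : ℝ) * (t * (Δ + Real.log q))) := by
  have hn' : (4 : ℝ) ≤ n := by exact_mod_cast hn
  have hn0 : (0 : ℝ) < n := by linarith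
  have hq' : (1 : ℝ) ≤ q := by exact_mod_cast hq
  have ht' : (1 : ℝ) ≤ t := by exact_mod_cast ht
  have hΔ' : (3 : ℝ) ≤ Δ := by exact_mod_cast hΔ
  have hlq : 0 ≤ Real.log q := Real.log_nonneg hq'
  have hl2 := Real.log_two_gt_d9
  have hl4 : Real.log 4 = 2 * Real.log 2 := by
    rw [← Real.log_rpow (by norm_num)]; norm_num
  have hln : 1 ≤ Real.log n := by
    have := Real.log_le_log (by norm_num) hn'
    linarith
  have hk : (Nat.log 2 n : ℝ) ≤ 2 * Real.log n := by
    have h1 : ((2 ^ Nat.log 2 n : ℕ) : ℝ) ≤ n := by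
      exact_mod_cast Nat.pow_log_le_self 2 (by omega)
    have h2 := Real.log_le_log (by positivity) h1
    rw [Nat.cast_pow, Real.log_pow, Nat.cast_ofNat] at h2
    nlinarith [Nat.cast_nonneg (α := ℝ) (Nat.log 2 n)]
  have hlog2 : Real.log 2 ≤ Real.log n := Real.log_le_log (by norm_num) (by linarith)
  set K : ℕ := 3 * ((t + 1) * (Nat.log 2 n + 1) + 1) + 1 with hK
  have hKle : (K : ℝ) + 1 ≤ 30 * t * Real.log n := by
    have h1 : (K : ℝ) + 1 = 3 * ((t + 1) * (Nat.log 2 n + 1)) + 5 := by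
      rw [hK]; push_cast; ring
    have h2 : ((t : ℝ) + 1) * (Nat.log 2 n + 1) ≤ (2 * t) * (3 * Real.log n) :=
      mul_le_mul (by linarith) (by linarith) (by positivity) (by positivity)
    have h3 : 1 ≤ t * Real.log n := by nlinarith
    nlinarith
  have hpos : (0 : ℝ) < ((n ^ 3 * q ^ K * (2 * (n * q)) : ℕ) : ℝ) := by
    have : 0 < n := by omega
    positivity
  rw [Real.le_rpow_iff_log_le hpos hn0]
  have hlog : Real.log ((n ^ 3 * q ^ K * (2 * (n * q)) : ℕ) : ℝ) =
      4 * Real.log n + Real.log 2 + (K + 1) * Real.log q := by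
    have hq0 : (q : ℝ) ≠ 0 := by positivity
    push_cast
    rw [Real.log_mul (by positivity) (by positivity), Real.log_mul (by positivity) (by positivity),
      Real.log_mul (by norm_num) (by positivity), Real.log_mul hn0.ne' hq0, Real.log_pow,
      Real.log_pow]
    push_cast
    ring
  rw [hlog]
  have h5 := mul_le_mul_of_nonneg_right hKle hlq
  have h6 : 3 ≤ (t : ℝ) * Δ := by nlinarith
  have h7 := mul_le_mul_of_nonneg_right h6 (by linarith : 0 ≤ Real.log n)
  nlinarith

theorem theorem4p5 :
    ∃ C : ℝ, 0 < C ∧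
      ∀ {V α : Type*} [Fintype V] (G : SimpleGraph V) [DecidableRel G.Adj]
        (L : V → Finset α) (n Δ t q : ℕ),
        Fintype.card V = n →
        G.maxDegree = Δ → 3 ≤ Δ →
        treewidth G = t → 1 ≤ t →
        (∀ v : V, G.degree v + 2 ≤ (L v).card ∧ (L v).card ≤ q) →
        ∃ T : ℕ, IsMixingTime G L T ∧
          (T : ℝ) ≤ (n : ℝ) ^ (C * (t * (Δ + Real.log q))) := by
  refine ⟨30, by norm_num, ?_⟩
  intro V α _ G _ L n Δ t q hn hΔ hΔ3 ht ht1 hL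
  have hne : Nonempty V := by
    by_contra h
    rw [not_nonempty_iff] at h
    have : G.maxDegree = 0 := by simp
    omega
  obtain ⟨v, hv⟩ := G.exists_maximal_degree_vertex
  have hdeg : 3 ≤ G.degree v := by omega
  have hn4 : 4 ≤ n := by
    have := G.degree_lt_card_verts v
    omega
  have hq1 : 2 ≤ q := by
    have := hL v
    omega
  obtain ⟨D, hD⟩ := exists_width_eq_treewidth G
  have hlay : HasLayout G Finset.univ ((t + 1) * (Nat.log 2 n + 1)) := by
    rw [← ht, ← hD]
    refine D.hasLayout (Nat.log 2 n + 1) Finset.univ ?_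
    rw [Finset.card_univ, hn]
    exact Nat.lt_pow_succ_log_self (by norm_num) n
  subst hn
  have hmix := hlay.tvDist_glauber_le (fun v => (hL v).1) (by omega : 1 ≤ q)
    (fun v => (hL v).2) (by nlinarith)
  classical
  -- The explicit time shows that the set of good times is nonempty, so it has a least element,
  -- which is no larger.
  refine ⟨Nat.find ⟨_, hmix⟩, ⟨Nat.find_spec ⟨_, hmix⟩, fun k hk => Nat.find_min' _ hk⟩, ?_⟩
  refine le_trans ?_ (natCast_le_rpow_of_treewidth_bound hn4 ht1 (by omega : 1 ≤ q) hΔ3)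
  exact_mod_cast Nat.find_min' _ hmix
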